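/- Let $\Sigma\in\mathbb R^{n\times n}$ be symmetric positive semidefinite and let $\rho\in\mathbb R^{n\times n}$ be symmetric with entries $\rho_{ij}\ge 0$, such that $\Sigma+\mathrm{Diag}(\rho)\succ 0$, where $\mathrm{Diag}(\rho)$ is the diagonal matrix with diagonal entries $\rho_{ii}$. Write $\langle X,Y\rangle=\mathrm{Tr}(XY^T)$, $\|X\|_F=\sqrt{\langle X,X\rangle}$, $\|\cdot\|$ for the operator norm associated with the Euclidean norm, and $\ast$ for the entrywise product. Put $\mathcal U=\{U\in\mathbb R^{n\times n}: U=U^T,\ |U_{ij}|\le 1\ \forall i,j\}$, $\alpha_\rho=1/(\|\Sigma\|+\|\rho\|)$, $\phi(X,U)=\log\det X-\langle \Sigma+\rho\ast U,X\rangle$, and for a fixed $\beta\ge\alpha_\rho$ let $$f_\rho(X)=\min_{U\in\mathcal U}\phi(X,U),\qquad g_{\rho,\beta}(U)=\max_{\alpha_\rho I\preceq X\preceq\beta I}\phi(X,U),$$ where $X$ ranges over symmetric matrices in the second formula, with $X_\beta(U)$ denoting the maximizer. Let $P_{\mathcal U}$ be the projection onto $\mathcal U$ in the norm $\|\cdot\|_F$,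 and let $\nabla g_{\rho,\beta}$ be the gradient with respect to $\langle\cdot,\cdot\rangle$. The SPG method is the following. Let $\epsilon_o>0$, $\gamma\in(0,1)$, $0<\sigma_1<\sigma_2<1$, $0<\alpha_{\min}<\alpha_{\max}<\infty$ and an integer $M\ge 1$ be given. Choose $U_0\in\mathcal U$ and $\alpha_0\in[\alpha_{\min},\alpha_{\max}]$, and set $k=0$. 1) If $g_{\rho,\beta}(U_k)-f_\rho(X_\beta(U_k))\le\epsilon_o$, terminate. 2) Compute $d_k=P_{\mathcal U}(U_k-\alpha_k\nabla g_{\rho,\beta}(U_k))-U_k$ and set $\lambda\leftarrow 1$. 2a) Set $U_+=U_k+\lambda d_k$. 2b) If $g_{\rho,\beta}(U_+)\le \max_{0\le j\le\min\{k,M-1\}}g_{\rho,\beta}(U_{k-j})+\gamma\lambda\langle d_k,\nabla g_{\rho,\beta}(U_k)\rangle$, set $U_{k+1}=U_+$, $s_k=U_{k+1}-U_k$ and $y_k=\nabla g_{\rho,\beta}(U_{k+1})-\nabla g_{\rho,\beta}(U_k)$. Otherwise choose any $\lambda_+\in[\sigma_1\lambda,\sigma_2\lambda]$, set $\lambda\leftarrow\lambda_+$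 and go to 2a). 2c) If $\langle s_k,y_k\rangle\le 0$, set $\alpha_{k+1}=\alpha_{\max}$; otherwise set $\alpha_{k+1}=\min\{\alpha_{\max},\max\{\alpha_{\min},\langle s_k,s_k\rangle/\langle s_k,y_k\rangle\}\}$. 3) Set $k\leftarrow k+1$ and go to 1). Then the method is well defined: for every $U\in\mathcal U$ the maximizer $X_\beta(U)$ exists and is unique and $g_{\rho,\beta}$ (defined by the same formula on $\mathbb R^{n\times n}$) is differentiable at $U$. Moreover, for every admissible choice of the parameters, of $U_0$, of $\alpha_0$ and of the numbers $\lambda_+$, the method terminates after finitely many iterations (counting also the inner iterations of the line search). At termination the duality gap satisfies $$g_{\rho,\beta}(U_k)-f_\rho(X_\beta(U_k))\le\epsilon_o,$$ and $(U_k,X_\beta(U_k))$ is a pair of $\epsilon_o$-optimal solutions of $\min\{g_{\rho,\beta}(U):U\in\mathcal U\}$ and $\max\{f_\rho(X):\alpha_\rho I\preceq X\preceq\beta I\}$; that is, $U_k\in\mathcal U$ and $g_{\rho,\beta}(U_k)\le g_{\rho,\beta}(U)+\epsilon_o$ for all $U\in\mathcal U$, while $\alpha_\rho I\preceq X_\beta(U_k)\preceq\beta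 I$ and $f_\rho(X_\beta(U_k))\ge f_\rho(X)-\epsilon_o$ for all symmetric $X$ with $\alpha_\rho I\preceq X\preceq\beta I$. -/

import Mathlib

namespace SparseCov

/-- The standard inner product `⟨X, Y⟩ = Tr (X Yᵀ)` on real matrices. -/
noncomputable def inn {n : ℕ} (X Y : Matrix (Fin n) (Fin n) ℝ) : ℝ :=
  (X * Y.transpose).trace

/-- The Frobenius norm `‖X‖_F = sqrt (Tr (X Xᵀ))`. -/
noncomputable def frobNorm {n : ℕ} (X : Matrix (Fin n) (Fin n) ℝ) : ℝ :=
  Real.sqrt (inn X X)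

/-- The operator norm of a matrix associated with the Euclidean norm on `ℝⁿ`. -/
noncomputable def specNorm {n : ℕ} (A : Matrix (Fin n) (Fin n) ℝ) : ℝ :=
  ‖Matrix.toEuclideanCLM (n := Fin n) (𝕜 := ℝ) A‖

/-- The lower eigenvalue bound `α_ρ = 1 / (‖Σ‖ + ‖ρ‖)`; the matrix `Σ` is written `S`. -/
noncomputable def alphaRho {n : ℕ} (S ρ : Matrix (Fin n) (Fin n) ℝ) : ℝ :=
  1 / (specNorm S + specNorm ρ)

/-- `𝒰`: the symmetric matrices with all entries in `[-1, 1]`. -/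
def setU (n : ℕ) : Set (Matrix (Fin n) (Fin n) ℝ) :=
  {U | U.IsSymm ∧ ∀ i j, |U i j| ≤ 1}

/-- The symmetric matrices `X` with `α_ρ I ⪯ X ⪯ β I`. -/
def boxX {n : ℕ} (S ρ : Matrix (Fin n) (Fin n) ℝ) (β : ℝ) :
    Set (Matrix (Fin n) (Fin n) ℝ) :=
  {X | X.IsSymm ∧ (X - alphaRho S ρ • (1 : Matrix (Fin n) (Fin n) ℝ)).PosSemidef ∧
    (β • (1 : Matrix (Fin n) (Fin n) ℝ) - X).PosSemidef}

/-- `φ(X, U) = log det X - ⟨Σ + ρ ∗ U, X⟩`, with `∗` the entrywise product. -/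
noncomputable def phi {n : ℕ} (S ρ X U : Matrix (Fin n) (Fin n) ℝ) : ℝ :=
  Real.log X.det - inn (S + Matrix.hadamard ρ U) X

/-- The primal objective `f_ρ(X) = min_{U ∈ 𝒰} φ(X, U)`. -/
noncomputable def fRho {n : ℕ} (S ρ X : Matrix (Fin n) (Fin n) ℝ) : ℝ :=
  sInf ((fun U => phi S ρ X U) '' setU n)

/-- The dual objective `g_{ρ,β}(U) = max {φ(X, U) : α_ρ I ⪯ X ⪯ β I}`. The formula makes sense
for every real `n × n` matrix `U`. -/
noncomputable def gRho {n : ℕ} (S ρ : Matrix (Fin n) (Fin n) ℝ) (β : ℝ)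
    (U : Matrix (Fin n) (Fin n) ℝ) : ℝ :=
  sSup ((fun X => phi S ρ X U) '' boxX S ρ β)

/-- `X` is an optimal solution of `max {φ(X, U) : α_ρ I ⪯ X ⪯ β I}`. -/
def IsInnerMax {n : ℕ} (S ρ : Matrix (Fin n) (Fin n) ℝ) (β : ℝ)
    (U X : Matrix (Fin n) (Fin n) ℝ) : Prop :=
  X ∈ boxX S ρ β ∧ ∀ Y ∈ boxX S ρ β, phi S ρ Y U ≤ phi S ρ X U

/-- `X_β(U)`: the optimal solution of `max {φ(X, U) : α_ρ I ⪯ X ⪯ β I}`. -/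
noncomputable def Xbeta {n : ℕ} (S ρ : Matrix (Fin n) (Fin n) ℝ) (β : ℝ)
    (U : Matrix (Fin n) (Fin n) ℝ) : Matrix (Fin n) (Fin n) ℝ :=
  Classical.epsilon (IsInnerMax S ρ β U)

/-- The gradient of `h` with respect to the inner product `⟨·,·⟩`: the matrix of partial
derivatives. For `h = g_{ρ,β}` with `ρ` symmetric, `h` depends only on the symmetric part of its
argument, so this is also the gradient of the restriction of `h` to symmetric matrices. -/
noncomputable def grad {n : ℕ} (h : Matrix (Fin n) (Fin n) ℝ → ℝ)
    (U : Matrix (Fin n) (Fin n) ℝ) : Matrix (Fin n) (Fin n) ℝ :=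
  Matrix.of fun i j => deriv (fun t : ℝ => h (U + t • Matrix.single i j (1 : ℝ))) 0

/-- The projection `P_𝒰(V) = argmin {‖W - V‖_F : W ∈ 𝒰}`. -/
noncomputable def projU {n : ℕ} (V : Matrix (Fin n) (Fin n) ℝ) : Matrix (Fin n) (Fin n) ℝ :=
  Classical.epsilon fun W =>
    W ∈ setU n ∧ ∀ Z ∈ setU n, frobNorm (W - V) ≤ frobNorm (Z - V)

/-- The duality gap `g_{ρ,β}(U) - f_ρ(X_β(U))`. -/
noncomputable def gap {n : ℕ} (S ρ : Matrix (Fin n) (Fin n) ℝ) (β : ℝ)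
    (U : Matrix (Fin n) (Fin n) ℝ) : ℝ :=
  gRho S ρ β U - fRho S ρ (Xbeta S ρ β U)

/-- The parameters `ε_o, γ, σ₁, σ₂, α_min, α_max, M` of the SPG method. -/
structure SPGParams where
  eps : ℝ
  gamma : ℝ
  sigma1 : ℝ
  sigma2 : ℝ
  alphaMin : ℝ
  alphaMax : ℝ
  M : ℕ

/-- The range of parameters that the method allows. -/
structure SPGParams.Valid (p : SPGParams) : Prop where
  eps_pos : 0 < p.eps
  gamma_pos : 0 < p.gamma
  gamma_lt_one : p.gamma < 1
  sigma1_pos : 0 < p.sigma1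
  sigma1_lt_sigma2 : p.sigma1 < p.sigma2
  sigma2_lt_one : p.sigma2 < 1
  alphaMin_pos : 0 < p.alphaMin
  alphaMin_lt_alphaMax : p.alphaMin < p.alphaMax
  one_le_M : 1 ≤ p.M

/-- The control point of the method: about to perform the stopping test of step 1), inside the
line search 2a)-2b) with direction `d = d_k` and trial step length `lam = λ`, or terminated. -/
inductive Phase (n : ℕ) where
  | test : Phase n
  | search (d : Matrix (Fin n) (Fin n) ℝ) (lam : ℝ) : Phase n
  | finished : Phase n

/-- A state of the SPG method: the counter `k`, the iterates `U 0, …, U k` (the values of `U`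
beyond `k` are irrelevant), the current spectral step length `α_k` and the control point. -/
structure SPGState (n : ℕ) where
  k : ℕ
  U : ℕ → Matrix (Fin n) (Fin n) ℝ
  stepLen : ℝ
  phase : Phase n

/-- The current iterate `U_k`. -/
def SPGState.cur {n : ℕ} (s : SPGState n) : Matrix (Fin n) (Fin n) ℝ := s.U s.k

/-- Initial states: `k = 0`, `U_0 ∈ 𝒰`, `α_0 ∈ [α_min, α_max]`. -/
def IsInitial {n : ℕ} (p : SPGParams) (s : SPGState n) : Prop :=
  s.k = 0 ∧ s.U 0 ∈ setU n ∧ s.stepLen ∈ Set.Icc p.alphaMin p.alphaMax ∧ s.phase = Phase.test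

/-- `g^M_k = max {h(U_{k-j}) : 0 ≤ j ≤ min {k, M-1}}`. -/
noncomputable def windowMax {n : ℕ} (h : Matrix (Fin n) (Fin n) ℝ → ℝ)
    (U : ℕ → Matrix (Fin n) (Fin n) ℝ) (k M : ℕ) : ℝ :=
  (Finset.range (min k (M - 1) + 1)).sup' Finset.nonempty_range_add_one fun j => h (U (k - j))

/-- The acceptance test `h(U_k + λ d) ≤ g^M_k + γ λ ⟨d, ∇h(U_k)⟩` of step 2b). -/
def Accept {n : ℕ} (h : Matrix (Fin n) (Fin n) ℝ → ℝ) (p : SPGParams) (s : SPGState n)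
    (d : Matrix (Fin n) (Fin n) ℝ) (lam : ℝ) : Prop :=
  h (s.cur + lam • d) ≤ windowMax h s.U s.k p.M + p.gamma * lam * inn d (grad h s.cur)

open Classical in
/-- Step 2c): the next spectral step length computed from `s_k` and `y_k`. -/
noncomputable def nextStepLen {n : ℕ} (p : SPGParams) (sk yk : Matrix (Fin n) (Fin n) ℝ) : ℝ :=
  if inn sk yk ≤ 0 then p.alphaMax
  else min p.alphaMax (max p.alphaMin (inn sk sk / inn sk yk))

/-- The direction `d_k = P_𝒰(U_k - α_k ∇g_{ρ,β}(U_k)) - U_k`. -/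
noncomputable def direction {n : ℕ} (S ρ : Matrix (Fin n) (Fin n) ℝ) (β : ℝ) (s : SPGState n) :
    Matrix (Fin n) (Fin n) ℝ :=
  projU (s.cur - s.stepLen • grad (gRho S ρ β) s.cur) - s.cur

/-- One elementary step of the SPG method. The only freedom is the choice of the reduced trial
step length `λ₊ ∈ [σ₁ λ, σ₂ λ]` in a backtracking step. -/
inductive Step {n : ℕ} (S ρ : Matrix (Fin n) (Fin n) ℝ) (β : ℝ) (p : SPGParams) :
    SPGState n → SPGState n → Prop
  /-- Step 1): the gap is at most `ε_o`, terminate. -/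
  | terminate (s : SPGState n) (hs : s.phase = Phase.test) (hgap : gap S ρ β s.cur ≤ p.eps) :
      Step S ρ β p s { s with phase := Phase.finished }
  /-- Step 2): the gap exceeds `ε_o`, compute `d_k` and set `λ = 1`. -/
  | startSearch (s : SPGState n) (hs : s.phase = Phase.test) (hgap : ¬ gap S ρ β s.cur ≤ p.eps) :
      Step S ρ β p s
        { s with phase := .search (direction S ρ β s) 1 }
  /-- Steps 2a), 2b), rejected: reduce `λ`. -/
  | backtrack (s : SPGState n) (d : Matrix (Fin n) (Fin n) ℝ) (lam lamPlus : ℝ)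
      (hs : s.phase = Phase.search d lam) (hrej : ¬ Accept (gRho S ρ β) p s d lam)
      (hlam : lamPlus ∈ Set.Icc (p.sigma1 * lam) (p.sigma2 * lam)) :
      Step S ρ β p s { s with phase := Phase.search d lamPlus }
  /-- Steps 2a), 2b), accepted, followed by 2c) and 3): `U_{k+1} = U_k + λ d_k`,
  `s_k = U_{k+1} - U_k`, `y_k = ∇g(U_{k+1}) - ∇g(U_k)`. -/
  | accept (s : SPGState n) (d : Matrix (Fin n) (Fin n) ℝ) (lam : ℝ)
      (hs : s.phase = Phase.search d lam) (hacc : Accept (gRho S ρ β) p s d lam) :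
      Step S ρ β p s
        { k := s.k + 1
          U := Function.update s.U (s.k + 1) (s.cur + lam • d)
          stepLen := nextStepLen p ((s.cur + lam • d) - s.cur)
            (grad (gRho S ρ β) (s.cur + lam • d) - grad (gRho S ρ β) s.cur)
          phase := Phase.test }

/-- `U` is an `ε`-optimal solution of `min {g_{ρ,β}(V) : V ∈ 𝒰}`. -/
def IsEpsOptDual {n : ℕ} (S ρ : Matrix (Fin n) (Fin n) ℝ) (β ε : ℝ)
    (U : Matrix (Fin n) (Fin n) ℝ) : Prop :=
  U ∈ setU n ∧ ∀ V ∈ setU n, gRho S ρ β U ≤ gRho S ρ β V + ε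

/-- `X` is an `ε`-optimal solution of `max {f_ρ(Y) : α_ρ I ⪯ Y ⪯ β I}`. -/
def IsEpsOptPrimal {n : ℕ} (S ρ : Matrix (Fin n) (Fin n) ℝ) (β ε : ℝ)
    (X : Matrix (Fin n) (Fin n) ℝ) : Prop :=
  X ∈ boxX S ρ β ∧ ∀ Y ∈ boxX S ρ β, fRho S ρ Y - ε ≤ fRho S ρ X

theorem inn_eq_sum {n : ℕ} (X Y : Matrix (Fin n) (Fin n) ℝ) :
    inn X Y = ∑ i, ∑ j, X i j * Y i j := by
  simp [inn, Matrix.trace, Matrix.mul_apply]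

/-- The minimum in the definition of `f_ρ` is attained, and `f_ρ` is the penalized
log-likelihood `log det X - ⟨Σ, X⟩ - ∑ ρ_ij |X_ij|`. -/
theorem fRho_isLeast {n : ℕ} (S ρ X : Matrix (Fin n) (Fin n) ℝ) (hρ : ∀ i j, 0 ≤ ρ i j)
    (hX : X.IsSymm) :
    IsLeast ((fun U => phi S ρ X U) '' setU n)
      (Real.log X.det - inn S X - ∑ i, ∑ j, ρ i j * |X i j|) := by
  have key : ∀ U, phi S ρ X U
      = Real.log X.det - inn S X - ∑ i, ∑ j, ρ i j * (U i j * X i j) := by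
    intro U
    simp only [phi, inn_eq_sum, Matrix.add_apply, Matrix.hadamard_apply, add_mul,
      Finset.sum_add_distrib, mul_assoc]
    ring
  constructor
  · refine ⟨Matrix.of fun i j => (SignType.sign (X i j) : ℝ), ⟨?_, ?_⟩, ?_⟩
    · ext i j
      simp [hX.apply i j]
    · intro i j
      rcases lt_trichotomy (X i j) 0 with h | h | h <;> simp [h]
    · simp [key, sign_mul_self]
  · rintro _ ⟨U, hU, rfl⟩
    simp only [key]
    gcongr with i _ j _
    · exact hρ i j
    · calc U i j * X i j ≤ |U i j * X i j| := le_abs_self _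
        _ = |U i j| * |X i j| := abs_mul _ _
        _ ≤ 1 * |X i j| := by gcongr; exact hU.2 i j
        _ = |X i j| := one_mul _

theorem fRho_eq {n : ℕ} (S ρ X : Matrix (Fin n) (Fin n) ℝ) (hρ : ∀ i j, 0 ≤ ρ i j)
    (hX : X.IsSymm) :
    fRho S ρ X = Real.log X.det - inn S X - ∑ i, ∑ j, ρ i j * |X i j| :=
  (fRho_isLeast S ρ X hρ hX).csInf_eq

end SparseCov

/-!
The function `φ(·, U)` is strongly concave on the box `α_ρ I ⪯ X ⪯ β I`, because `log det` is.
Midpoint strong concavity (`inn_self_le_log_det`) follows from `det B ≤ exp (Tr B - n)` for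
`B ⪰ 0`, and it gives the quadratic growth `‖X - Y‖² ≤ 4 β² (φ(X, U) - φ(Y, U))` away from the
maximizer `X = X_β(U)` (`IsInnerMax.inn_sub_le`). Since the box is compact, the maximizer exists and
is unique. As `φ` is affine in `U`, the quadratic growth also yields the two-sided bound
`0 ≤ g(U + D) - g(U) + ⟨ρ ∗ D, X_β(U)⟩ ≤ β² ‖ρ ∗ D‖²` (`gRho_sub_le_gRho_add`, `gRho_add_le`).
This shows at once that `g` is differentiable with gradient `-ρ ∗ X_β(U)` and that it satisfies the
descent inequality `g(U + D) ≤ g(U) + ⟨D, ∇g(U)⟩ + K ‖D‖²` with one constant `K`.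

The duality gap at `U` equals `max {-⟨V - U, ∇g(U)⟩ : V ∈ 𝒰}`, so by the variational inequality of
the projection it is at most a constant times `‖d‖`, where `d` is the search direction. Hence `‖d‖²`
is bounded below as long as the gap exceeds `ε_o` (`exists_direction_lower_bound`). Together with
`⟨d, ∇g(U)⟩ ≤ -‖d‖² / α_max` and the descent inequality, the line search accepts every step length
below a fixed threshold (`exists_accept_threshold`), and every accepted step lowers `g` below the
maximum over the last `M` iterates by at least a fixed `δ > 0`. Inductively
`g(U_k) ≤ g(U_0) - δ k / M` (`exists_invariant_step`), while weak duality bounds `g` below on `𝒰`.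
So only finitely many outer iterations occur, each with a bounded number of trial steps; a potential
that drops by one at each elementary step makes this precise (`not_exists_infinite_run`). At
termination, weak duality turns the bound on the gap into `ε_o`-optimality of both points.
-/

namespace SparseCov

open Matrix

/-! ### Strong concavity of the log-determinant -/

open scoped MatrixOrder ComplexOrder in
theorem exists_symm_sqrt {n : ℕ} {A : Matrix (Fin n) (Fin n) ℝ} (hA : A.PosSemidef) :
    ∃ R : Matrix (Fin n) (Fin n) ℝ, Rᵀ = R ∧ R * R = A :=
  ⟨CFC.sqrt A, by simpa using (CFC.sqrt_nonneg A).posSemidef.isHermitian.eq,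
    CFC.sqrt_mul_sqrt_self A hA.nonneg⟩

theorem posSemidef_conj {n : ℕ} {A R : Matrix (Fin n) (Fin n) ℝ} (hA : A.PosSemidef)
    (hR : Rᵀ = R) : (R * A * R).PosSemidef := by
  have h := hA.conjTranspose_mul_mul_same R
  rwa [conjTranspose_eq_transpose_of_trivial, hR] at h

theorem trace_mul_nonneg {n : ℕ} {A B : Matrix (Fin n) (Fin n) ℝ} (hA : A.PosSemidef)
    (hB : B.PosSemidef) : 0 ≤ (A * B).trace := by
  obtain ⟨R, hR, rfl⟩ := exists_symm_sqrt hA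
  have h := (posSemidef_conj hB hR).trace_nonneg
  rwa [trace_mul_comm, ← Matrix.mul_assoc] at h

/-- If `0 ⪯ A ⪯ β I` and `B ⪰ 0`, then `Tr (A B) ≤ β Tr B`. -/
theorem trace_mul_le {n : ℕ} {A B : Matrix (Fin n) (Fin n) ℝ} {β : ℝ}
    (hA : (β • (1 : Matrix (Fin n) (Fin n) ℝ) - A).PosSemidef)
    (hB : B.PosSemidef) : (A * B).trace ≤ β * B.trace := by
  have h := trace_mul_nonneg hA hB
  simp only [sub_mul, trace_sub, smul_mul_assoc, one_mul, trace_smul, smul_eq_mul] at h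
  linarith

theorem det_le_exp_trace_sub {n : ℕ} {B : Matrix (Fin n) (Fin n) ℝ} (hB : B.PosSemidef) :
    B.det ≤ Real.exp (B.trace - n) := by
  have h1 := hB.isHermitian.det_eq_prod_eigenvalues
  have h2 := hB.isHermitian.trace_eq_sum_eigenvalues
  simp only [RCLike.ofReal_real_eq_id, id] at h1 h2
  rw [h1, h2]
  calc ∏ i, hB.isHermitian.eigenvalues i
      ≤ ∏ i, Real.exp (hB.isHermitian.eigenvalues i - 1) := by
        refine Finset.prod_le_prod (fun i _ => hB.eigenvalues_nonneg i) fun i _ => ?_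
        linarith [Real.add_one_le_exp (hB.isHermitian.eigenvalues i - 1)]
    _ = Real.exp (∑ i, hB.isHermitian.eigenvalues i - n) := by
        rw [← Real.exp_sum]; simp

/-- Strong concavity of `log det` on `{0 ≺ A ⪯ β I}`, in midpoint form. With `A = R²` and
`E = R⁻¹ D R⁻¹` the bracket is `-log det (1 - E²) ≥ Tr (E²)`, and
`‖D‖_F² = Tr (A E A E) ≤ β² Tr (E²)`. -/
theorem inn_self_le_log_det {n : ℕ} {A D : Matrix (Fin n) (Fin n) ℝ} {β : ℝ} (hβ : 0 ≤ β)
    (hA : A.PosDef) (hD : Dᵀ = D) (hp : (A + D).PosDef) (hm : (A - D).PosDef)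
    (hAβ : (β • (1 : Matrix (Fin n) (Fin n) ℝ) - A).PosSemidef) :
    inn D D ≤ β ^ 2 *
      (2 * Real.log A.det - Real.log (A + D).det - Real.log (A - D).det) := by
  obtain ⟨R, hR, hRA⟩ := exists_symm_sqrt hA.posSemidef
  have hdet : R.det * R.det = A.det := by rw [← det_mul, hRA]
  have hA0 := hA.det_pos
  have hR0 : R.det ≠ 0 := by rintro h; rw [h] at hdet; simp at hdet; linarith
  have hRu : IsUnit R.det := isUnit_iff_ne_zero.mpr hR0
  set E := R⁻¹ * D * R⁻¹ with hE
  have hRiT : (R⁻¹)ᵀ = R⁻¹ := by rw [transpose_nonsing_inv, hR]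
  have hET : Eᵀ = E := by
    simp only [hE, transpose_mul, hRiT, hD, Matrix.mul_assoc]
  have hRiA : R⁻¹ * A * R⁻¹ = 1 := by
    rw [← hRA, ← Matrix.mul_assoc, nonsing_inv_mul _ hRu, Matrix.one_mul, mul_nonsing_inv _ hRu]
  have hDE : R * E * R = D := by
    simp only [hE, Matrix.mul_assoc, nonsing_inv_mul _ hRu, Matrix.mul_one]
    rw [← Matrix.mul_assoc, mul_nonsing_inv _ hRu, Matrix.one_mul]
  have hEp : (1 + E).PosSemidef := by
    have := posSemidef_conj hp.posSemidef hRiT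
    rwa [Matrix.mul_add, Matrix.add_mul, hRiA] at this
  have hEm : (1 - E).PosSemidef := by
    have := posSemidef_conj hm.posSemidef hRiT
    rwa [Matrix.mul_sub, Matrix.sub_mul, hRiA] at this
  have hpE : A + D = R * (1 + E) * R := by
    rw [Matrix.mul_add, Matrix.add_mul, hDE, Matrix.mul_one, hRA]
  have hmE : A - D = R * (1 - E) * R := by
    rw [Matrix.mul_sub, Matrix.sub_mul, hDE, Matrix.mul_one, hRA]
  have hB : (1 - E * E).PosSemidef := by
    have h := ((posSemidef_conj hEm (R := 1 + E) (by simp [hET])).add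
      (posSemidef_conj hEp (R := 1 - E) (by simp [hET]))).smul (a := (1 / 2 : ℝ)) (by norm_num)
    have heq : (1 + E) * (1 - E) * (1 + E) + (1 - E) * (1 + E) * (1 - E)
        = (2 : ℝ) • (1 - E * E) := by
      rw [two_smul]; noncomm_ring
    rwa [heq, smul_smul, one_div, inv_mul_cancel₀ (two_ne_zero), one_smul] at h
  have hprod : (A + D).det * (A - D).det = A.det ^ 2 * (1 - E * E).det := by
    have : (1 - E * E) = (1 + E) * (1 - E) := by noncomm_ring
    rw [this, hpE, hmE]
    simp only [det_mul]
    rw [← hdet]; ring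
  have hp0 := hp.det_pos
  have hm0 := hm.det_pos
  have hB0 : 0 < (1 - E * E).det := by
    have : 0 < A.det ^ 2 * (1 - E * E).det := by rw [← hprod]; positivity
    exact (pos_iff_pos_of_mul_pos this).mp (by positivity)
  have hlog : Real.log (A + D).det + Real.log (A - D).det
      = 2 * Real.log A.det + Real.log (1 - E * E).det := by
    rw [← Real.log_mul hp0.ne' hm0.ne', hprod, Real.log_mul (by positivity) hB0.ne', Real.log_pow]
    push_cast; ring
  have hlogB : Real.log (1 - E * E).det ≤ - (E * E).trace := by
    have h := Real.log_le_log hB0 (det_le_exp_trace_sub hB)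
    rw [Real.log_exp, trace_sub, trace_one, Fintype.card_fin] at h
    linarith
  have hEE : (E * E).PosSemidef := by
    simpa using posSemidef_conj (Matrix.PosSemidef.one (n := Fin n) (R := ℝ)) hET
  have hinn : inn D D ≤ β ^ 2 * (E * E).trace := by
    have h1 : inn D D = (A * (E * A * E)).trace := by
      rw [inn, hD, ← hDE, ← hRA]
      rw [show R * E * R * (R * E * R) = (R * E * (R * R) * E) * R by noncomm_ring,
        trace_mul_comm]
      congr 1; noncomm_ring
    have h2 : (A * (E * A * E)).trace ≤ β * (E * A * E).trace :=
      trace_mul_le hAβ (posSemidef_conj hA.posSemidef hET)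
    have h3 : (E * A * E).trace ≤ β * (E * E).trace := by
      rw [show (E * A * E).trace = (A * (E * E)).trace by
        rw [Matrix.mul_assoc, trace_mul_comm, Matrix.mul_assoc]]
      exact trace_mul_le hAβ hEE
    nlinarith
  nlinarith [sq_nonneg β]

/-! ### The trace inner product -/

section Inn
variable {n : ℕ} (X Y Z : Matrix (Fin n) (Fin n) ℝ) (c : ℝ)

theorem inn_comm : inn X Y = inn Y X := by simp [inn_eq_sum, mul_comm]

theorem inn_add_left : inn (X + Y) Z = inn X Z + inn Y Z := by
  simp [inn, Matrix.add_mul]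

theorem inn_smul_left : inn (c • X) Z = c * inn X Z := by
  simp [inn]

theorem inn_add_right : inn Z (X + Y) = inn Z X + inn Z Y := by
  simp [inn, Matrix.mul_add]

theorem inn_sub_right : inn Z (X - Y) = inn Z X - inn Z Y := by
  simp [inn, Matrix.mul_sub]

theorem inn_neg_right : inn Z (-X) = -inn Z X := by
  simp [inn]

theorem inn_smul_right : inn Z (c • X) = c * inn Z X := by
  simp [inn]

theorem inn_self_nonneg : 0 ≤ inn X X := by
  rw [inn_eq_sum]
  exact Finset.sum_nonneg fun i _ => Finset.sum_nonneg fun j _ => mul_self_nonneg _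

theorem sq_le_inn_self (i j : Fin n) : X i j ^ 2 ≤ inn X X := by
  rw [inn_eq_sum, sq]
  refine le_trans ?_ (Finset.single_le_sum (f := fun i => ∑ j, X i j * X i j)
    (fun i _ => Finset.sum_nonneg fun j _ => mul_self_nonneg _) (Finset.mem_univ i))
  exact Finset.single_le_sum (f := fun j => X i j * X i j)
    (fun j _ => mul_self_nonneg _) (Finset.mem_univ j)

variable {X} in
theorem eq_zero_of_inn_self_nonpos (h : inn X X ≤ 0) : X = 0 := by
  ext i j
  have := (sq_le_inn_self X i j).trans h
  exact pow_eq_zero_iff (two_ne_zero) |>.mp (le_antisymm this (sq_nonneg _))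

theorem inn_sq_le : inn X Y ^ 2 ≤ inn X X * inn Y Y := by
  simp only [inn_eq_sum, ← Fintype.sum_prod_type', ← sq]
  exact Finset.sum_mul_sq_le_sq_mul_sq _ _ _

variable {X c} in
theorem inn_self_le_of_abs_le (h : ∀ i j, |X i j| ≤ c) : inn X X ≤ n ^ 2 * c ^ 2 := by
  rw [inn_eq_sum]
  calc ∑ i, ∑ j, X i j * X i j ≤ ∑ _i : Fin n, ∑ _j : Fin n, c ^ 2 := by
        gcongr with i _ j _
        rw [← sq, ← sq_abs]
        gcongr
        exact h i j
    _ = n ^ 2 * c ^ 2 := by simp; ring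

variable {Y} in
theorem inn_hadamard_single (i j : Fin n) :
    inn (hadamard X (c • Matrix.single i j (1 : ℝ))) Y = c * (X i j * Y i j) := by
  rw [inn_eq_sum, Finset.sum_eq_single i, Finset.sum_eq_single j]
  · simp; ring
  · intro b _ hb; simp [hb.symm]
  · simp
  · intro b _ hb; exact Finset.sum_eq_zero fun k _ => by simp [hb.symm]
  · simp

end Inn

/-! ### The feasible sets -/

variable {n : ℕ} {S ρ : Matrix (Fin n) (Fin n) ℝ} {β : ℝ}

theorem alphaRho_nonneg : 0 ≤ alphaRho S ρ :=
  one_div_nonneg.mpr (add_nonneg (norm_nonneg _) (norm_nonneg _))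

theorem alphaRho_pos [Nonempty (Fin n)] (hpd : (S + diagonal ρ.diag).PosDef) :
    0 < alphaRho S ρ := by
  refine one_div_pos.mpr (lt_of_le_of_ne (add_nonneg (norm_nonneg _) (norm_nonneg _)) ?_)
  intro h
  have h1 := (add_eq_zero_iff_of_nonneg (norm_nonneg _) (norm_nonneg _)).mp h.symm
  have hS : S = 0 := by simpa using h1.1
  have hρ : ρ = 0 := by simpa using h1.2
  have := hpd.diag_pos (i := Classical.arbitrary (Fin n))
  simp [hS, hρ] at this

/-- For `n = 0` the bound `α_ρ` is the junk value `1 / 0 = 0`, but then every matrix is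
positive definite. -/
theorem posDef_of_mem_boxX (hpd : (S + diagonal ρ.diag).PosDef)
    {X : Matrix (Fin n) (Fin n) ℝ} (hX : X ∈ boxX S ρ β) : X.PosDef := by
  rcases isEmpty_or_nonempty (Fin n) with h | h
  · rwa [Subsingleton.elim X (S + diagonal ρ.diag)]
  · have := (Matrix.PosDef.one (n := Fin n) (R := ℝ)).smul (alphaRho_pos hpd)
    simpa using this.add_posSemidef hX.2.1

theorem smul_one_mem_boxX (hβ : alphaRho S ρ ≤ β) :
    alphaRho S ρ • (1 : Matrix (Fin n) (Fin n) ℝ) ∈ boxX S ρ β := by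
  refine ⟨by simp [Matrix.IsSymm], by simpa using PosSemidef.zero, ?_⟩
  rw [← sub_smul]
  exact PosSemidef.one.smul (sub_nonneg.mpr hβ)

theorem convex_boxX : Convex ℝ (boxX S ρ β) := by
  intro X hX Y hY a b ha hb hab
  refine ⟨(hX.1.smul a).add (hY.1.smul b), ?_, ?_⟩
  · have := (hX.2.1.smul ha).add (hY.2.1.smul hb)
    convert this using 1
    rw [smul_sub, smul_sub, sub_add_sub_comm, ← add_smul, hab, one_smul]
  · have := (hX.2.2.smul ha).add (hY.2.2.smul hb)
    convert this using 1
    rw [smul_sub, smul_sub, sub_add_sub_comm, ← add_smul, hab, one_smul]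

theorem isClosed_setOf_posSemidef : IsClosed {X : Matrix (Fin n) (Fin n) ℝ | X.PosSemidef} := by
  simp only [posSemidef_iff_dotProduct_mulVec, Set.ofPred_and, Set.ofPred_forall]
  refine IsClosed.inter (isClosed_eq (by fun_prop) (by fun_prop)) ?_
  exact isClosed_iInter fun x => isClosed_le (by fun_prop) (by fun_prop)

theorem isClosed_boxX : IsClosed (boxX S ρ β) := by
  refine IsClosed.inter (isClosed_eq (by fun_prop) (by fun_prop)) (IsClosed.inter ?_ ?_)
  · exact isClosed_setOf_posSemidef.preimage (f := fun X => X - alphaRho S ρ • 1) (by fun_prop)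
  · exact isClosed_setOf_posSemidef.preimage (f := fun X => β • 1 - X) (by fun_prop)

theorem isCompact_of_isClosed_of_abs_le {s : Set (Matrix (Fin n) (Fin n) ℝ)} (hs : IsClosed s)
    {c : ℝ} (hc : ∀ X ∈ s, ∀ i j, |X i j| ≤ c) : IsCompact s := by
  have h : IsCompact (Set.univ.pi fun _ : Fin n => Set.univ.pi fun _ : Fin n => Set.Icc (-c) c) :=
    isCompact_univ_pi fun _ => isCompact_univ_pi fun _ => isCompact_Icc
  exact h.of_isClosed_subset hs fun X hX i _ j _ => abs_le.mp (hc X hX i j)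

theorem abs_le_of_mem_boxX (hpd : (S + diagonal ρ.diag).PosDef) (hβ : alphaRho S ρ ≤ β)
    {X : Matrix (Fin n) (Fin n) ℝ} (hX : X ∈ boxX S ρ β) (i j : Fin n) :
    |X i j| ≤ n * β := by
  have hβ0 : 0 ≤ β := alphaRho_nonneg.trans hβ
  have hn : (1 : ℝ) ≤ n := by exact_mod_cast (Fin.pos i)
  have hX0 := (posDef_of_mem_boxX hpd hX).posSemidef
  have h1 : inn X X ≤ β * X.trace := by
    rw [inn, hX.1.eq]; exact trace_mul_le hX.2.2 hX0
  have h2 : X.trace ≤ β * n := by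
    have := hX.2.2.trace_nonneg
    simp [trace_sub] at this
    linarith
  refine abs_le_of_sq_le_sq ?_ (by positivity)
  calc X i j ^ 2 ≤ inn X X := sq_le_inn_self X i j
    _ ≤ β * (β * n) := h1.trans (by gcongr)
    _ ≤ (n * β) ^ 2 := by nlinarith [sq_nonneg β]

theorem isCompact_boxX (hpd : (S + diagonal ρ.diag).PosDef) (hβ : alphaRho S ρ ≤ β) :
    IsCompact (boxX S ρ β) :=
  isCompact_of_isClosed_of_abs_le isClosed_boxX fun _ hX => abs_le_of_mem_boxX hpd hβ hX

theorem convex_setU : Convex ℝ (setU n) := by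
  intro X hX Y hY a b ha hb hab
  refine ⟨(hX.1.smul a).add (hY.1.smul b), fun i j => ?_⟩
  calc |(a • X + b • Y) i j| ≤ |a * X i j| + |b * Y i j| := abs_add_le _ _
    _ = a * |X i j| + b * |Y i j| := by rw [abs_mul, abs_mul, abs_of_nonneg ha, abs_of_nonneg hb]
    _ ≤ a * 1 + b * 1 := by gcongr; exacts [hX.2 i j, hY.2 i j]
    _ = 1 := by linarith

theorem isCompact_setU : IsCompact (setU n) := by
  refine isCompact_of_isClosed_of_abs_le (c := 1) ?_ fun _ hX => hX.2
  have h : IsClosed {U : Matrix (Fin n) (Fin n) ℝ | ∀ i j, |U i j| ≤ 1} := by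
    simp only [Set.ofPred_forall]
    exact isClosed_iInter fun i => isClosed_iInter fun j =>
      isClosed_le (by fun_prop) continuous_const
  exact IsClosed.inter (isClosed_eq (by fun_prop) (by fun_prop)) h

theorem zero_mem_setU : (0 : Matrix (Fin n) (Fin n) ℝ) ∈ setU n :=
  ⟨isSymm_zero, by simp⟩

/-! ### The inner maximization and the dual function -/

theorem phi_add (X U D : Matrix (Fin n) (Fin n) ℝ) :
    phi S ρ X (U + D) = phi S ρ X U - inn (hadamard ρ D) X := by
  simp only [phi, hadamard_add, ← add_assoc, inn_add_left]; ring

theorem continuousOn_phi (hpd : (S + diagonal ρ.diag).PosDef) (U : Matrix (Fin n) (Fin n) ℝ) :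
    ContinuousOn (fun X => phi S ρ X U) (boxX S ρ β) := by
  unfold phi inn
  refine ContinuousOn.sub (ContinuousOn.log (by fun_prop) fun X hX => ?_) (by fun_prop)
  exact (posDef_of_mem_boxX hpd hX).det_pos.ne'

/-- Quadratic growth of `φ(·, U)` away from its maximizer over the box. -/
theorem IsInnerMax.inn_sub_le (hpd : (S + diagonal ρ.diag).PosDef) (hβ : alphaRho S ρ ≤ β)
    {U X Y : Matrix (Fin n) (Fin n) ℝ} (hX : IsInnerMax S ρ β U X) (hY : Y ∈ boxX S ρ β) :
    inn (X - Y) (X - Y) ≤ 4 * β ^ 2 * (phi S ρ X U - phi S ρ Y U) := by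
  set A := (1 / 2 : ℝ) • X + (1 / 2 : ℝ) • Y with hA
  have hAm : A ∈ boxX S ρ β :=
    convex_boxX hX.1 hY (by norm_num) (by norm_num) (by norm_num)
  have hp : A + (1 / 2 : ℝ) • (X - Y) = X := by rw [hA]; module
  have hm : A - (1 / 2 : ℝ) • (X - Y) = Y := by rw [hA]; module
  have h := inn_self_le_log_det (A := A) (D := (1 / 2 : ℝ) • (X - Y)) (β := β)
    (alphaRho_nonneg.trans hβ) (posDef_of_mem_boxX hpd hAm)
    (by rw [transpose_smul, transpose_sub, hX.1.1.eq, hY.1.eq])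
    (by rw [hp]; exact posDef_of_mem_boxX hpd hX.1)
    (by rw [hm]; exact posDef_of_mem_boxX hpd hY) hAm.2.2
  rw [hp, hm, inn_smul_left, inn_smul_right] at h
  have hmax := hX.2 A hAm
  have hlin : 2 * phi S ρ A U - phi S ρ X U - phi S ρ Y U
      = 2 * Real.log A.det - Real.log X.det - Real.log Y.det := by
    simp only [phi, hA, inn_add_right, inn_smul_right]; ring
  have : 2 * Real.log A.det - Real.log X.det - Real.log Y.det ≤ phi S ρ X U - phi S ρ Y U := by
    linarith
  nlinarith [mul_le_mul_of_nonneg_left this (sq_nonneg β)]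

theorem existsUnique_isInnerMax (hpd : (S + diagonal ρ.diag).PosDef) (hβ : alphaRho S ρ ≤ β)
    (U : Matrix (Fin n) (Fin n) ℝ) : ∃! X, IsInnerMax S ρ β U X := by
  obtain ⟨X, hX, hmax⟩ := (isCompact_boxX hpd hβ).exists_isMaxOn ⟨_, smul_one_mem_boxX hβ⟩
    (continuousOn_phi hpd U)
  have hXm : IsInnerMax S ρ β U X := ⟨hX, fun Y hY => hmax hY⟩
  refine ⟨X, hXm, fun Y hY => ?_⟩
  have h := hXm.inn_sub_le hpd hβ hY.1
  have h2 := hY.2 X hX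
  refine (sub_eq_zero.mp (eq_zero_of_inn_self_nonpos (h.trans ?_))).symm
  exact mul_nonpos_of_nonneg_of_nonpos (by positivity) (by linarith)

theorem isInnerMax_Xbeta (hpd : (S + diagonal ρ.diag).PosDef) (hβ : alphaRho S ρ ≤ β)
    (U : Matrix (Fin n) (Fin n) ℝ) : IsInnerMax S ρ β U (Xbeta S ρ β U) :=
  Classical.epsilon_spec (existsUnique_isInnerMax hpd hβ U).exists

theorem IsInnerMax.gRho_eq {U X : Matrix (Fin n) (Fin n) ℝ} (hX : IsInnerMax S ρ β U X) :
    gRho S ρ β U = phi S ρ X U :=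
  IsGreatest.csSup_eq ⟨⟨X, hX.1, rfl⟩, by rintro _ ⟨Y, hY, rfl⟩; exact hX.2 Y hY⟩

theorem phi_le_gRho (hpd : (S + diagonal ρ.diag).PosDef) (hβ : alphaRho S ρ ≤ β)
    (U : Matrix (Fin n) (Fin n) ℝ) {X : Matrix (Fin n) (Fin n) ℝ} (hX : X ∈ boxX S ρ β) :
    phi S ρ X U ≤ gRho S ρ β U := by
  rw [(isInnerMax_Xbeta hpd hβ U).gRho_eq]
  exact (isInnerMax_Xbeta hpd hβ U).2 X hX

theorem gRho_sub_le_gRho_add (hpd : (S + diagonal ρ.diag).PosDef) (hβ : alphaRho S ρ ≤ β)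
    (U D : Matrix (Fin n) (Fin n) ℝ) :
    gRho S ρ β U - inn (hadamard ρ D) (Xbeta S ρ β U) ≤ gRho S ρ β (U + D) := by
  have h := isInnerMax_Xbeta hpd hβ U
  rw [h.gRho_eq, ← phi_add]
  exact phi_le_gRho hpd hβ _ h.1

/-- The quadratic upper bound for `g_{ρ,β}`: the quadratic growth of `φ(·, U)` absorbs the change
of the maximizer between `U` and `U + D`. -/
theorem gRho_add_le (hpd : (S + diagonal ρ.diag).PosDef) (hβ : alphaRho S ρ ≤ β)
    (U D : Matrix (Fin n) (Fin n) ℝ) :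
    gRho S ρ β (U + D) ≤ gRho S ρ β U - inn (hadamard ρ D) (Xbeta S ρ β U)
      + β ^ 2 * inn (hadamard ρ D) (hadamard ρ D) := by
  have h := isInnerMax_Xbeta hpd hβ U
  have h' := isInnerMax_Xbeta hpd hβ (U + D)
  rw [h.gRho_eq, h'.gRho_eq, phi_add]
  set X := Xbeta S ρ β U
  set Y := Xbeta S ρ β (U + D)
  set W := hadamard ρ D
  have hgrow := h.inn_sub_le hpd hβ h'.1
  have hcs := inn_sq_le W (X - Y)
  have hlin : inn W (X - Y) = inn W X - inn W Y := inn_sub_right _ _ _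
  have hW := inn_self_nonneg W
  have hgap : 0 ≤ phi S ρ X U - phi S ρ Y U := sub_nonneg.mpr (h.2 Y h'.1)
  -- `⟨W, X - Y⟩ ≤ 2 β ‖W‖ (φ(X) - φ(Y))^{1/2} ≤ β² ‖W‖² + φ(X) - φ(Y)`
  have hmain : inn W (X - Y) ≤ β ^ 2 * inn W W + (phi S ρ X U - phi S ρ Y U) := by
    refine le_of_sq_le_sq ?_ (by positivity)
    calc inn W (X - Y) ^ 2 ≤ inn W W * (4 * β ^ 2 * (phi S ρ X U - phi S ρ Y U)) :=
          hcs.trans (mul_le_mul_of_nonneg_left hgrow hW)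
      _ ≤ _ := by nlinarith [sq_nonneg (β ^ 2 * inn W W - (phi S ρ X U - phi S ρ Y U))]
  linarith

/-! ### Differentiability of the dual function -/

/-- The linear form `D ↦ -⟨ρ ∗ D, X⟩`. -/
noncomputable def hadamardForm (ρ X : Matrix (Fin n) (Fin n) ℝ) :
    Matrix (Fin n) (Fin n) ℝ →L[ℝ] ℝ where
  toFun D := -inn (hadamard ρ D) X
  map_add' D E := by rw [hadamard_add, inn_add_left]; ring
  map_smul' c D := by rw [hadamard_smul, inn_smul_left]; simp
  cont := by unfold inn; simp only [Matrix.trace, diag, Matrix.mul_apply, hadamard_apply]; fun_prop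

theorem abs_gRho_add_sub_le (hpd : (S + diagonal ρ.diag).PosDef) (hβ : alphaRho S ρ ≤ β)
    (U D : Matrix (Fin n) (Fin n) ℝ) :
    |gRho S ρ β (U + D) - gRho S ρ β U - hadamardForm ρ (Xbeta S ρ β U) D|
      ≤ β ^ 2 * inn (hadamard ρ D) (hadamard ρ D) := by
  have h1 := gRho_sub_le_gRho_add hpd hβ U D
  have h2 := gRho_add_le hpd hβ U D
  change |_ - _ - -inn (hadamard ρ D) _| ≤ _
  rw [abs_of_nonneg (by linarith)]
  linarith

section
-- This norm induces the product topology, so it proves differentiability for that topology.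
attribute [local instance] Matrix.normedAddCommGroup Matrix.normedSpace

theorem hasFDerivAt_gRho (hpd : (S + diagonal ρ.diag).PosDef) (hβ : alphaRho S ρ ≤ β)
    (U : Matrix (Fin n) (Fin n) ℝ) :
    HasFDerivAt (gRho S ρ β) (hadamardForm ρ (Xbeta S ρ β U)) U := by
  refine hasFDerivAt_iff_isLittleO_nhds_zero.mpr ?_
  have hO : (fun D => gRho S ρ β (U + D) - gRho S ρ β U - hadamardForm ρ (Xbeta S ρ β U) D)
      =O[nhds 0] fun D : Matrix (Fin n) (Fin n) ℝ => ‖D‖ ^ 2 := by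
    refine Asymptotics.IsBigO.of_bound (β ^ 2 * (n ^ 2 * ‖ρ‖ ^ 2)) (Filter.Eventually.of_forall ?_)
    intro D
    rw [Real.norm_eq_abs, Real.norm_of_nonneg (by positivity)]
    refine (abs_gRho_add_sub_le hpd hβ U D).trans ?_
    have h : inn (hadamard ρ D) (hadamard ρ D) ≤ n ^ 2 * (‖ρ‖ * ‖D‖) ^ 2 := by
      refine inn_self_le_of_abs_le fun i j => ?_
      rw [hadamard_apply, abs_mul]
      exact mul_le_mul (norm_entry_le_entrywise_sup_norm ρ) (norm_entry_le_entrywise_sup_norm D)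
        (abs_nonneg _) (norm_nonneg _)
    calc _ ≤ β ^ 2 * (n ^ 2 * (‖ρ‖ * ‖D‖) ^ 2) := by gcongr
      _ = _ := by ring
  exact hO.trans_isLittleO (Asymptotics.isLittleO_norm_pow_id one_lt_two)

theorem differentiableAt_gRho (hpd : (S + diagonal ρ.diag).PosDef) (hβ : alphaRho S ρ ≤ β)
    (U : Matrix (Fin n) (Fin n) ℝ) : DifferentiableAt ℝ (gRho S ρ β) U :=
  (hasFDerivAt_gRho hpd hβ U).differentiableAt

theorem grad_gRho (hpd : (S + diagonal ρ.diag).PosDef) (hβ : alphaRho S ρ ≤ β)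
    (U : Matrix (Fin n) (Fin n) ℝ) :
    grad (gRho S ρ β) U = -hadamard ρ (Xbeta S ρ β U) := by
  ext i j
  have hline : HasDerivAt (fun t : ℝ => U + t • Matrix.single i j (1 : ℝ))
      (Matrix.single i j (1 : ℝ)) 0 := by
    have h := ((hasDerivAt_id (0 : ℝ)).smul_const (Matrix.single i j (1 : ℝ))).const_add U
    simp only [id, one_smul] at h
    exact h
  have hU : HasFDerivAt (gRho S ρ β) (hadamardForm ρ (Xbeta S ρ β U))
      (U + (0 : ℝ) • Matrix.single i j (1 : ℝ)) := by
    rw [zero_smul, add_zero]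
    exact hasFDerivAt_gRho hpd hβ U
  have h := HasFDerivAt.comp_hasDerivAt (0 : ℝ) hU hline
  refine h.deriv.trans ?_
  have := inn_hadamard_single ρ 1 (Y := Xbeta S ρ β U) i j
  rw [one_smul, one_mul] at this
  exact congrArg Neg.neg this

end

theorem inn_grad_gRho (hpd : (S + diagonal ρ.diag).PosDef) (hβ : alphaRho S ρ ≤ β)
    (U D : Matrix (Fin n) (Fin n) ℝ) :
    inn D (grad (gRho S ρ β) U) = -inn (hadamard ρ D) (Xbeta S ρ β U) := by
  rw [grad_gRho hpd hβ, inn_neg_right]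
  simp only [inn_eq_sum, hadamard_apply]
  congr! 3
  ring

/-- The descent lemma for `g_{ρ,β}`. -/
theorem exists_descent_const (hpd : (S + diagonal ρ.diag).PosDef) (hβ : alphaRho S ρ ≤ β) :
    ∃ K > 0, ∀ U D : Matrix (Fin n) (Fin n) ℝ, gRho S ρ β (U + D) ≤
      gRho S ρ β U + inn D (grad (gRho S ρ β) U) + K * inn D D := by
  refine ⟨β ^ 2 * inn ρ ρ + 1, by have := inn_self_nonneg ρ; positivity, fun U D => ?_⟩
  have h := gRho_add_le hpd hβ U D
  rw [inn_grad_gRho hpd hβ]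
  have hW : inn (hadamard ρ D) (hadamard ρ D) ≤ inn ρ ρ * inn D D := by
    rw [inn_eq_sum, inn_eq_sum D D, Finset.mul_sum]
    refine Finset.sum_le_sum fun i _ => ?_
    rw [Finset.mul_sum]
    refine Finset.sum_le_sum fun j _ => ?_
    rw [hadamard_apply]
    nlinarith [mul_le_mul_of_nonneg_right (sq_le_inn_self ρ i j) (sq_nonneg (D i j))]
  have := mul_le_mul_of_nonneg_left hW (sq_nonneg β)
  nlinarith [inn_self_nonneg D]

/-! ### Duality -/

theorem phi_eq_add_inn (X U V : Matrix (Fin n) (Fin n) ℝ) :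
    phi S ρ X V = phi S ρ X U - inn (hadamard ρ (V - U)) X := by
  rw [← phi_add, add_sub_cancel]

theorem fRho_le_phi (hρ : ∀ i j, 0 ≤ ρ i j) {X V : Matrix (Fin n) (Fin n) ℝ} (hX : X.IsSymm)
    (hV : V ∈ setU n) : fRho S ρ X ≤ phi S ρ X V :=
  csInf_le ⟨_, (fRho_isLeast S ρ X hρ hX).2⟩ ⟨V, hV, rfl⟩

theorem fRho_le_gRho (hpd : (S + diagonal ρ.diag).PosDef) (hβ : alphaRho S ρ ≤ β)
    (hρ : ∀ i j, 0 ≤ ρ i j) {X U : Matrix (Fin n) (Fin n) ℝ} (hX : X ∈ boxX S ρ β)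
    (hU : U ∈ setU n) : fRho S ρ X ≤ gRho S ρ β U :=
  (fRho_le_phi hρ hX.1 hU).trans (phi_le_gRho hpd hβ U hX)

theorem isEpsOptDual_of_gap_le (hpd : (S + diagonal ρ.diag).PosDef) (hβ : alphaRho S ρ ≤ β)
    (hρ : ∀ i j, 0 ≤ ρ i j) {U : Matrix (Fin n) (Fin n) ℝ} (hU : U ∈ setU n) {ε : ℝ}
    (h : gap S ρ β U ≤ ε) : IsEpsOptDual S ρ β ε U := by
  refine ⟨hU, fun V hV => ?_⟩
  have := fRho_le_gRho hpd hβ hρ (isInnerMax_Xbeta hpd hβ U).1 hV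
  unfold gap at h
  linarith

theorem isEpsOptPrimal_of_gap_le (hpd : (S + diagonal ρ.diag).PosDef) (hβ : alphaRho S ρ ≤ β)
    (hρ : ∀ i j, 0 ≤ ρ i j) {U : Matrix (Fin n) (Fin n) ℝ} (hU : U ∈ setU n) {ε : ℝ}
    (h : gap S ρ β U ≤ ε) : IsEpsOptPrimal S ρ β ε (Xbeta S ρ β U) := by
  refine ⟨(isInnerMax_Xbeta hpd hβ U).1, fun Y hY => ?_⟩
  have := fRho_le_gRho hpd hβ hρ hY hU
  unfold gap at h
  linarith

/-- The duality gap is the Frank–Wolfe gap of `g_{ρ,β}` over `𝒰`. -/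
theorem exists_gap_eq (hpd : (S + diagonal ρ.diag).PosDef) (hβ : alphaRho S ρ ≤ β)
    (hρ : ∀ i j, 0 ≤ ρ i j) (U : Matrix (Fin n) (Fin n) ℝ) :
    ∃ V ∈ setU n, gap S ρ β U = -inn (V - U) (grad (gRho S ρ β) U) := by
  have h := isInnerMax_Xbeta hpd hβ U
  have hleast := fRho_isLeast S ρ (Xbeta S ρ β U) hρ h.1.1
  obtain ⟨V, hV, hVeq⟩ := hleast.1
  refine ⟨V, hV, ?_⟩
  rw [gap, fRho, hleast.csInf_eq, ← hVeq, h.gRho_eq, inn_grad_gRho hpd hβ]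
  simp only [phi_eq_add_inn (Xbeta S ρ β U) U V]
  ring

/-! ### The projection and the search direction -/

theorem projU_spec (V : Matrix (Fin n) (Fin n) ℝ) :
    projU V ∈ setU n ∧ ∀ Z ∈ setU n, frobNorm (projU V - V) ≤ frobNorm (Z - V) := by
  obtain ⟨W, hW, hmin⟩ := (isCompact_setU (n := n)).exists_isMinOn ⟨0, zero_mem_setU⟩
    (f := fun W => frobNorm (W - V)) (by unfold frobNorm inn; fun_prop)
  exact Classical.epsilon_spec (p := fun W => W ∈ setU n ∧ ∀ Z ∈ setU n,
    frobNorm (W - V) ≤ frobNorm (Z - V)) ⟨W, hW, fun Z hZ => hmin hZ⟩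

/-- The variational inequality that characterizes the projection onto the convex set `𝒰`. -/
theorem inn_projU_nonneg (V : Matrix (Fin n) (Fin n) ℝ) {Z : Matrix (Fin n) (Fin n) ℝ}
    (hZ : Z ∈ setU n) : 0 ≤ inn (projU V - V) (Z - projU V) := by
  obtain ⟨hW, hmin⟩ := projU_spec V
  set W := projU V
  have key : ∀ t ∈ Set.Ioc (0 : ℝ) 1, 0 ≤ 2 * inn (W - V) (Z - W) + t * inn (Z - W) (Z - W) := by
    intro t ht
    have h := hmin _ (convex_setU hW hZ (sub_nonneg.mpr ht.2) ht.1.le (by ring))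
    rw [frobNorm, frobNorm, Real.sqrt_le_sqrt_iff (inn_self_nonneg _)] at h
    have heq : (1 - t) • W + t • Z - V = (W - V) + t • (Z - W) := by module
    rw [heq] at h
    simp only [inn_add_left, inn_add_right, inn_smul_left, inn_smul_right,
      inn_comm (Z - W) (W - V)] at h
    have : 0 ≤ t * (2 * inn (W - V) (Z - W) + t * inn (Z - W) (Z - W)) := by linarith
    exact (mul_nonneg_iff_of_pos_left ht.1).mp this
  by_contra! hneg
  have hN := inn_self_nonneg (Z - W)
  -- a step length at which the first-order decrease dominates the quadratic term
  set t := min 1 (-inn (W - V) (Z - W) / (inn (Z - W) (Z - W) + 1)) with ht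
  have ht0 : 0 < t := lt_min one_pos (div_pos (by linarith) (by linarith))
  have h := key t ⟨ht0, min_le_left _ _⟩
  have h2 : t * (inn (Z - W) (Z - W) + 1) ≤ -inn (W - V) (Z - W) :=
    (le_div_iff₀ (by linarith)).mp (min_le_right _ _)
  nlinarith

/-- The search direction at `U` with gradient `G` and spectral step length `a` is a descent
direction. -/
theorem inn_projU_sub_le {U G : Matrix (Fin n) (Fin n) ℝ} {a : ℝ} (ha : 0 < a)
    (hU : U ∈ setU n) :
    inn (projU (U - a • G) - U) G ≤ -(inn (projU (U - a • G) - U) (projU (U - a • G) - U) / a) := by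
  have h := inn_projU_nonneg (U - a • G) hU
  set d := projU (U - a • G) - U with hd
  have h1 : projU (U - a • G) - (U - a • G) = d + a • G := by rw [hd]; abel
  have h2 : U - projU (U - a • G) = -d := by rw [hd]; abel
  rw [h1, h2, inn_neg_right, inn_add_left, inn_smul_left, inn_comm G d] at h
  rw [le_neg, div_le_iff₀ ha]
  linarith

/-- The Frank–Wolfe gap at `U` is controlled by the length of the search direction. -/
theorem neg_inn_le_inn_projU {U V G : Matrix (Fin n) (Fin n) ℝ} {a : ℝ} (ha : 0 < a)
    (hV : V ∈ setU n) :
    -inn (V - U) G ≤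
      inn (projU (U - a • G) - U) (a⁻¹ • (V - projU (U - a • G)) - G) := by
  have h := inn_projU_nonneg (U - a • G) hV
  set P := projU (U - a • G)
  have h1 : P - (U - a • G) = (P - U) + a • G := by abel
  rw [h1, inn_add_left, inn_smul_left] at h
  have h2 : a⁻¹ * (inn (P - U) (V - P) + a * inn G (V - P))
      = a⁻¹ * inn (P - U) (V - P) + inn G (V - P) := by field_simp
  have h3 := mul_nonneg (inv_nonneg.mpr ha.le) h
  rw [h2] at h3
  rw [inn_sub_right, inn_smul_right]
  have h4 : inn (V - U) G = inn G (V - P) + inn (P - U) G := by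
    rw [inn_comm G, ← inn_add_left, sub_add_sub_cancel]
  linarith

/-! ### Uniform bounds for one iteration -/

theorem inn_direction_grad_le {p : SPGParams} (hp : p.Valid) {s : SPGState n}
    (hU : s.cur ∈ setU n) (hs : s.stepLen ∈ Set.Icc p.alphaMin p.alphaMax) :
    inn (direction S ρ β s) (grad (gRho S ρ β) s.cur) ≤
      -(inn (direction S ρ β s) (direction S ρ β s) / p.alphaMax) := by
  have ha : 0 < s.stepLen := hp.alphaMin_pos.trans_le hs.1
  refine (inn_projU_sub_le ha hU).trans (neg_le_neg ?_)
  exact div_le_div_of_nonneg_left (inn_self_nonneg _) ha hs.2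

theorem le_windowMax (h : Matrix (Fin n) (Fin n) ℝ → ℝ) (s : SPGState n) (M : ℕ) :
    h s.cur ≤ windowMax h s.U s.k M :=
  Finset.le_sup' (fun j => h (s.U (s.k - j))) (Finset.mem_range.mpr (Nat.succ_pos _))

/-- The line search accepts every step below a threshold that depends only on the data. -/
theorem exists_accept_threshold (hpd : (S + diagonal ρ.diag).PosDef) (hβ : alphaRho S ρ ≤ β)
    {p : SPGParams} (hp : p.Valid) :
    ∃ l > 0, ∀ s : SPGState n, s.cur ∈ setU n → s.stepLen ∈ Set.Icc p.alphaMin p.alphaMax →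
      ∀ lam, 0 < lam → lam ≤ l → Accept (gRho S ρ β) p s (direction S ρ β s) lam := by
  obtain ⟨K, hK, hdesc⟩ := exists_descent_const (S := S) (ρ := ρ) hpd hβ
  have hamax : 0 < p.alphaMax := hp.alphaMin_pos.trans hp.alphaMin_lt_alphaMax
  have hγ := hp.gamma_lt_one
  refine ⟨(1 - p.gamma) / (K * p.alphaMax), div_pos (by linarith) (by positivity), ?_⟩
  intro s hU hs lam hlam0 hlam
  unfold Accept
  have h1 := hdesc s.cur (lam • direction S ρ β s)
  have h2 := inn_direction_grad_le (S := S) (ρ := ρ) (β := β) hp hU hs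
  have h3 := le_windowMax (gRho S ρ β) s p.M
  set d := direction S ρ β s
  set G := grad (gRho S ρ β) s.cur
  simp only [inn_smul_left, inn_smul_right] at h1
  -- below the threshold the quadratic term is at most a fraction `1 - γ` of the linear decrease
  have h4 : lam * K * inn d d ≤ (1 - p.gamma) * (inn d d / p.alphaMax) := by
    rw [le_div_iff₀ (by positivity)] at hlam
    rw [← mul_div_assoc, le_div_iff₀ hamax]
    nlinarith [mul_le_mul_of_nonneg_right hlam (inn_self_nonneg d)]
  have h5 : lam * K * inn d d ≤ -((1 - p.gamma) * inn d G) := by nlinarith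
  nlinarith [mul_le_mul_of_nonneg_left h5 hlam0.le]

/-- As long as the gap exceeds `ε_o`, the search directions are bounded away from zero. -/
theorem exists_direction_lower_bound (hpd : (S + diagonal ρ.diag).PosDef)
    (hβ : alphaRho S ρ ≤ β) (hρ : ∀ i j, 0 ≤ ρ i j) {p : SPGParams} (hp : p.Valid) :
    ∃ c > 0, ∀ s : SPGState n, s.stepLen ∈ Set.Icc p.alphaMin p.alphaMax →
      ¬ gap S ρ β s.cur ≤ p.eps → c ≤ inn (direction S ρ β s) (direction S ρ β s) := by
  have hβ0 : 0 ≤ β := alphaRho_nonneg.trans hβ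
  have hamin := hp.alphaMin_pos
  set b := p.alphaMin⁻¹ * 2 + Real.sqrt (inn ρ ρ) * (n * β) with hb
  have hC : 0 < (n : ℝ) ^ 2 * b ^ 2 + 1 := by positivity
  refine ⟨p.eps ^ 2 / ((n : ℝ) ^ 2 * b ^ 2 + 1), div_pos (pow_pos hp.eps_pos 2) hC, ?_⟩
  intro s hs hgap
  have ha : 0 < s.stepLen := hamin.trans_le hs.1
  obtain ⟨V, hV, hVgap⟩ := exists_gap_eq hpd hβ hρ s.cur
  have h1 := neg_inn_le_inn_projU (U := s.cur) (G := grad (gRho S ρ β) s.cur) ha hV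
  rw [← hVgap] at h1
  set P := projU (s.cur - s.stepLen • grad (gRho S ρ β) s.cur)
  have hP : P ∈ setU n := (projU_spec _).1
  set A := s.stepLen⁻¹ • (V - P) - grad (gRho S ρ β) s.cur with hA
  have hAb : inn A A ≤ n ^ 2 * b ^ 2 := by
    refine inn_self_le_of_abs_le fun i j => ?_
    have hX := abs_le_of_mem_boxX hpd hβ (isInnerMax_Xbeta hpd hβ s.cur).1 i j
    have hρij : |ρ i j| ≤ Real.sqrt (inn ρ ρ) := Real.abs_le_sqrt (sq_le_inn_self ρ i j)
    have hVP : |V i j - P i j| ≤ 2 := by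
      have := abs_sub (V i j) (P i j)
      linarith [hV.2 i j, hP.2 i j]
    have hentry : A i j = s.stepLen⁻¹ * (V i j - P i j) + ρ i j * Xbeta S ρ β s.cur i j := by
      rw [hA, grad_gRho hpd hβ]; simp
    rw [hentry]
    refine (abs_add_le _ _).trans ?_
    rw [abs_mul, abs_mul, abs_of_pos (inv_pos.mpr ha)]
    refine add_le_add (mul_le_mul (inv_anti₀ hamin hs.1) hVP (abs_nonneg _) (by positivity)) ?_
    exact mul_le_mul hρij hX (abs_nonneg _) (Real.sqrt_nonneg _)
  have h2 : p.eps ^ 2 ≤ inn (P - s.cur) A ^ 2 :=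
    pow_le_pow_left₀ hp.eps_pos.le ((not_le.mp hgap).le.trans h1) 2
  have h3 := inn_sq_le (P - s.cur) A
  change _ ≤ inn (P - s.cur) (P - s.cur)
  rw [div_le_iff₀ hC]
  nlinarith [mul_le_mul_of_nonneg_left hAb (inn_self_nonneg (P - s.cur)),
    inn_self_nonneg (P - s.cur)]

theorem nextStepLen_mem {p : SPGParams} (hp : p.Valid) (X Y : Matrix (Fin n) (Fin n) ℝ) :
    nextStepLen p X Y ∈ Set.Icc p.alphaMin p.alphaMax := by
  have h := hp.alphaMin_lt_alphaMax.le
  unfold nextStepLen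
  split_ifs
  · exact ⟨h, le_rfl⟩
  · exact ⟨le_min h (le_max_left _ _), min_le_left _ _⟩

/-! ### The invariant of an execution -/

/-- The invariant of the states of an execution: trial step lengths are at least `l`, and the
objective has decreased from `G` at the average rate `δ / M` per iteration. -/
structure Invariant (S ρ : Matrix (Fin n) (Fin n) ℝ) (β : ℝ) (p : SPGParams) (l δ G : ℝ)
    (s : SPGState n) : Prop where
  cur_mem : s.cur ∈ setU n
  stepLen_mem : s.stepLen ∈ Set.Icc p.alphaMin p.alphaMax
  decrease : ∀ j ≤ s.k, gRho S ρ β (s.U j) ≤ G - δ * (j / p.M)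
  search : ∀ d lam, s.phase = Phase.search d lam →
    d = direction S ρ β s ∧ lam ∈ Set.Icc l 1 ∧ ¬ gap S ρ β s.cur ≤ p.eps
  finished : s.phase = Phase.finished → gap S ρ β s.cur ≤ p.eps

theorem IsInitial.invariant {p : SPGParams} {s : SPGState n} (hs : IsInitial p s) (l δ : ℝ) :
    Invariant S ρ β p l δ (gRho S ρ β (s.U 0)) s := by
  obtain ⟨hk, hU, hstep, hphase⟩ := hs
  refine ⟨by rwa [SPGState.cur, hk], hstep, fun j hj => ?_, ?_, ?_⟩
  · obtain rfl : j = 0 := by omega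
    simp
  · simp [hphase]
  · simp [hphase]

theorem add_smul_direction_mem {s : SPGState n} (hU : s.cur ∈ setU n) {lam : ℝ}
    (h0 : 0 ≤ lam) (h1 : lam ≤ 1) : s.cur + lam • direction S ρ β s ∈ setU n := by
  have := convex_setU hU
    (projU_spec (s.cur - s.stepLen • grad (gRho S ρ β) s.cur)).1 (sub_nonneg.mpr h1) h0 (by ring)
  convert this using 1
  rw [direction]; module

theorem windowMax_le {p : SPGParams} (hp : p.Valid) {l δ G : ℝ} (hδ : 0 ≤ δ) {s : SPGState n}
    (hI : Invariant S ρ β p l δ G s) :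
    windowMax (gRho S ρ β) s.U s.k p.M ≤ G - δ * ((s.k + 1) / p.M) + δ := by
  have hM : (0 : ℝ) < p.M := by exact_mod_cast hp.one_le_M
  refine Finset.sup'_le _ _ fun j hj => ?_
  have hj' : j ≤ s.k ∧ j + 1 ≤ p.M := by
    have := Finset.mem_range.mp hj
    have := hp.one_le_M
    omega
  refine (hI.decrease (s.k - j) (Nat.sub_le _ _)).trans ?_
  have h1 : ((s.k : ℝ) + 1) / p.M - 1 ≤ ((s.k - j : ℕ) : ℝ) / p.M := by
    rw [Nat.cast_sub hj'.1, sub_le_iff_le_add, div_add_one hM.ne']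
    have : (j : ℝ) + 1 ≤ p.M := by exact_mod_cast hj'.2
    exact div_le_div_of_nonneg_right (by linarith) hM.le
  nlinarith [mul_le_mul_of_nonneg_left h1 hδ]

/-- The constants `l` and `δ` for which every step preserves the invariant. -/
theorem exists_invariant_step (hpd : (S + diagonal ρ.diag).PosDef)
    (hβ : alphaRho S ρ ≤ β) (hρ : ∀ i j, 0 ≤ ρ i j) {p : SPGParams} (hp : p.Valid) :
    ∃ l > 0, l ≤ 1 ∧ ∃ δ > 0, ∀ (G : ℝ) (s t : SPGState n),
      Invariant S ρ β p l δ G s → Step S ρ β p s t → Invariant S ρ β p l δ G t := by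
  obtain ⟨l₀, hl₀, haccept⟩ := exists_accept_threshold (S := S) (ρ := ρ) hpd hβ hp
  obtain ⟨c, hc, hdir⟩ := exists_direction_lower_bound hpd hβ hρ hp
  have hamax : 0 < p.alphaMax := hp.alphaMin_pos.trans hp.alphaMin_lt_alphaMax
  have hσ := hp.sigma1_pos
  have hσ2 := hp.sigma1_pos.trans hp.sigma1_lt_sigma2
  have hγ := hp.gamma_pos
  -- a rejected trial step exceeds `l₀`, so that its successor is at least `σ₁ l₀`
  set l := min 1 (p.sigma1 * l₀) with hl
  have hl0 : 0 < l := lt_min one_pos (by positivity)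
  set δ := p.gamma * l * (c / p.alphaMax) with hδ
  have hδ0 : 0 < δ := by positivity
  refine ⟨l, hl0, min_le_left _ _, δ, hδ0, fun G s t hI hstep => ?_⟩
  cases hstep with
  | terminate hs hgap =>
    exact ⟨hI.cur_mem, hI.stepLen_mem, hI.decrease, by simp, fun _ => hgap⟩
  | startSearch hs hgap =>
    refine ⟨hI.cur_mem, hI.stepLen_mem, hI.decrease, ?_, by simp⟩
    rintro d lam h
    cases h
    exact ⟨rfl, ⟨min_le_left _ _, le_rfl⟩, hgap⟩
  | backtrack d lam lamPlus hs hrej hlam =>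
    obtain ⟨hd, hlam1, hgap⟩ := hI.search d lam hs
    have hlam0 : 0 < lam := hl0.trans_le hlam1.1
    refine ⟨hI.cur_mem, hI.stepLen_mem, hI.decrease, ?_, by simp⟩
    rintro d' lam' h
    cases h
    refine ⟨hd, ⟨?_, ?_⟩, hgap⟩
    · have : l₀ < lam := by
        by_contra! hle
        rw [hd] at hrej
        exact hrej (haccept s hI.cur_mem hI.stepLen_mem lam hlam0 hle)
      calc l ≤ p.sigma1 * l₀ := min_le_right _ _
        _ ≤ p.sigma1 * lam := by gcongr
        _ ≤ lamPlus := hlam.1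
    · have := hp.sigma2_lt_one
      nlinarith [hlam.2, hlam1.2]
  | accept d lam hs hacc =>
    obtain ⟨hd, hlam1, hgap⟩ := hI.search d lam hs
    have hlam0 : 0 < lam := hl0.trans_le hlam1.1
    subst hd
    refine ⟨?_, nextStepLen_mem hp _ _, ?_, by simp, by simp⟩
    · simpa [SPGState.cur] using add_smul_direction_mem hI.cur_mem hlam0.le hlam1.2
    · intro j hj
      rcases Nat.lt_or_eq_of_le hj with hj | rfl
      · have hj' : j ≠ s.k + 1 := ne_of_lt hj
        simpa [Function.update_of_ne hj'] using hI.decrease j (Nat.lt_succ_iff.mp hj)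
      · simp only [Function.update_self]
        have h1 := windowMax_le hp hδ0.le hI
        have h2 := inn_direction_grad_le (S := S) (ρ := ρ) (β := β) hp hI.cur_mem hI.stepLen_mem
        have h3 := hdir s hI.stepLen_mem hgap
        have h4 : p.gamma * lam * inn (direction S ρ β s) (grad (gRho S ρ β) s.cur) ≤ -δ := by
          have h5 : c / p.alphaMax ≤ -inn (direction S ρ β s) (grad (gRho S ρ β) s.cur) :=
            (div_le_div_of_nonneg_right h3 hamax.le).trans (by linarith)
          have h6 : δ ≤ p.gamma * lam * -inn (direction S ρ β s) (grad (gRho S ρ β) s.cur) := by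
            rw [hδ]
            exact mul_le_mul (mul_le_mul_of_nonneg_left hlam1.1 hγ.le) h5 (by positivity)
              (by positivity)
          linarith
        have h7 := hacc
        unfold Accept at h7
        push_cast
        linarith

/-! ### Termination -/

/-- The part of the potential that depends on the control point: one backtracking step multiplies
the trial step length by at most `σ₂` and so decreases `log λ / log (1 / σ₂)` by at least one. -/
noncomputable def phasePotential (p : SPGParams) : Phase n → ℝ
  | Phase.test => 1
  | Phase.search _ lam => Real.log lam / -Real.log p.sigma2
  | Phase.finished => 0

/-- A potential that every step decreases by at least one. The number `Q` bounds the number of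
backtracking steps of a line search. -/
noncomputable def potential (p : SPGParams) (Q : ℝ) (s : SPGState n) : ℝ :=
  phasePotential p s.phase - (Q + 2) * s.k

theorem neg_log_sigma2_pos {p : SPGParams} (hp : p.Valid) : 0 < -Real.log p.sigma2 :=
  neg_pos.mpr (Real.log_neg (hp.sigma1_pos.trans hp.sigma1_lt_sigma2) hp.sigma2_lt_one)

theorem neg_le_phasePotential {p : SPGParams} (hp : p.Valid) {l δ G : ℝ} (hl : 0 < l)
    (hl1 : l ≤ 1) {s : SPGState n} (hI : Invariant S ρ β p l δ G s) :
    -(Real.log l / Real.log p.sigma2) ≤ phasePotential p s.phase := by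
  have hL := neg_log_sigma2_pos hp
  have hQ : -(Real.log l / Real.log p.sigma2) ≤ 0 := by
    rw [← div_neg]
    exact div_nonpos_of_nonpos_of_nonneg (Real.log_nonpos hl.le hl1) hL.le
  rcases hphase : s.phase with _ | ⟨d, lam⟩ | _
  · exact hQ.trans zero_le_one
  · rw [← div_neg]
    exact div_le_div_of_nonneg_right (Real.log_le_log hl (hI.search d lam hphase).2.1.1) hL.le
  · exact hQ

theorem potential_step_le {p : SPGParams} (hp : p.Valid) {l δ G : ℝ} (hl : 0 < l)
    (hl1 : l ≤ 1) {s t : SPGState n} (hI : Invariant S ρ β p l δ G s) (h : Step S ρ β p s t) :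
    potential p (Real.log l / Real.log p.sigma2) t ≤
      potential p (Real.log l / Real.log p.sigma2) s - 1 := by
  have hL := neg_log_sigma2_pos hp
  have hlow := neg_le_phasePotential hp hl hl1 hI
  cases h with
  | terminate hs hgap => simp [potential, hs, phasePotential]
  | startSearch hs hgap => simp [potential, hs, phasePotential]
  | backtrack d lam lamPlus hs hrej hlam =>
    have hlam0 : 0 < lam := hl.trans_le (hI.search d lam hs).2.1.1
    have hσ2 := hp.sigma1_pos.trans hp.sigma1_lt_sigma2
    have h1 : Real.log lamPlus ≤ Real.log p.sigma2 + Real.log lam := by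
      rw [← Real.log_mul hσ2.ne' hlam0.ne']
      exact Real.log_le_log ((mul_pos hp.sigma1_pos hlam0).trans_le hlam.1) hlam.2
    have h2 : Real.log lamPlus / -Real.log p.sigma2 ≤ Real.log lam / -Real.log p.sigma2 - 1 := by
      rw [div_le_iff₀ hL, sub_mul, div_mul_cancel₀ _ hL.ne']
      linarith
    simp only [potential, hs, phasePotential]
    linarith
  | accept d lam hs hacc =>
    simp only [potential, phasePotential] at hlow ⊢
    push_cast
    linarith

/-- The objective is bounded below on `𝒰`, so the guaranteed decrease bounds the number of
iterations. -/
theorem Invariant.k_le (hpd : (S + diagonal ρ.diag).PosDef) (hβ : alphaRho S ρ ≤ β)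
    (hρ : ∀ i j, 0 ≤ ρ i j) {p : SPGParams} (hp : p.Valid) {l δ G : ℝ} (hδ : 0 < δ)
    {s : SPGState n} (hI : Invariant S ρ β p l δ G s) :
    (s.k : ℝ) ≤ (G - fRho S ρ (alphaRho S ρ • 1)) / δ * p.M := by
  have hM : (0 : ℝ) < p.M := by exact_mod_cast hp.one_le_M
  have h1 := fRho_le_gRho hpd hβ hρ (smul_one_mem_boxX hβ) hI.cur_mem
  have h2 := hI.decrease s.k le_rfl
  rw [← div_le_iff₀ hM, le_div_iff₀ hδ]
  simp only [SPGState.cur] at h1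
  linarith

theorem not_exists_infinite_run (hpd : (S + diagonal ρ.diag).PosDef) (hβ : alphaRho S ρ ≤ β)
    (hρ : ∀ i j, 0 ≤ ρ i j) {p : SPGParams} (hp : p.Valid) {s₀ : SPGState n}
    (hs₀ : IsInitial p s₀) :
    ¬ ∃ run : ℕ → SPGState n, run 0 = s₀ ∧ ∀ t, Step S ρ β p (run t) (run (t + 1)) := by
  rintro ⟨run, h0, hrun⟩
  obtain ⟨l, hl, hl1, δ, hδ, hpres⟩ := exists_invariant_step hpd hβ hρ hp
  have hI : ∀ t, Invariant S ρ β p l δ (gRho S ρ β (s₀.U 0)) (run t) := by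
    intro t
    induction t with
    | zero => rw [h0]; exact hs₀.invariant l δ
    | succ t ih => exact hpres _ _ _ ih (hrun t)
  set Q := Real.log l / Real.log p.sigma2
  have hQ0 : 0 ≤ Q := div_nonneg_of_nonpos (Real.log_nonpos hl.le hl1)
    (by linarith [neg_log_sigma2_pos hp])
  have hpot : ∀ t : ℕ, potential p Q (run t) ≤ potential p Q s₀ - t := by
    intro t
    induction t with
    | zero => simp [h0]
    | succ t ih =>
      have := potential_step_le hp hl hl1 (hI t) (hrun t)
      push_cast
      linarith
  set N := (gRho S ρ β (s₀.U 0) - fRho S ρ (alphaRho S ρ • 1)) / δ * p.M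
  obtain ⟨t, ht⟩ := exists_nat_gt (potential p Q s₀ + Q + (Q + 2) * N)
  have h1 := hpot t
  have h2 := neg_le_phasePotential hp hl hl1 (hI t)
  have h3 := mul_le_mul_of_nonneg_left ((hI t).k_le hpd hβ hρ hp hδ) (by linarith : 0 ≤ Q + 2)
  rw [potential] at h1
  linarith

theorem exists_step {p : SPGParams} (hp : p.Valid) {l δ G : ℝ} (hl : 0 < l)
    {s : SPGState n} (hI : Invariant S ρ β p l δ G s) (hs : s.phase ≠ Phase.finished) :
    ∃ t, Step S ρ β p s t := by
  rcases hphase : s.phase with _ | ⟨d, lam⟩ | _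
  · by_cases hgap : gap S ρ β s.cur ≤ p.eps
    · exact ⟨_, Step.terminate s hphase hgap⟩
    · exact ⟨_, Step.startSearch s hphase hgap⟩
  · by_cases hacc : Accept (gRho S ρ β) p s d lam
    · exact ⟨_, Step.accept s d lam hphase hacc⟩
    · have hlam : 0 < lam := hl.trans_le (hI.search d lam hphase).2.1.1
      exact ⟨_, Step.backtrack s d lam (p.sigma1 * lam) hphase hacc
        ⟨le_rfl, mul_le_mul_of_nonneg_right hp.sigma1_lt_sigma2.le hlam.le⟩⟩
  · exact absurd hphase hs

end SparseCov

theorem mainTheorem3 {n : ℕ} (S ρ : Matrix (Fin n) (Fin n) ℝ)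
    (hS : S.PosSemidef) (hρ_symm : ρ.IsSymm) (hρ_nonneg : ∀ i j, 0 ≤ ρ i j)
    (hpd : (S + Matrix.diagonal ρ.diag).PosDef)
    (β : ℝ) (hβ : SparseCov.alphaRho S ρ ≤ β)
    (p : SparseCov.SPGParams) (hp : p.Valid)
    (s₀ : SparseCov.SPGState n) (hs₀ : SparseCov.IsInitial p s₀) :
    -- the quantities that the method uses are well defined
    (∀ U ∈ SparseCov.setU n,
      (∃! X, SparseCov.IsInnerMax S ρ β U X) ∧
      DifferentiableAt ℝ (SparseCov.gRho S ρ β) U) ∧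
    -- there is no infinite execution, whatever choices are made in the line searches
    (¬ ∃ run : ℕ → SparseCov.SPGState n, run 0 = s₀ ∧
      ∀ t, SparseCov.Step S ρ β p (run t) (run (t + 1))) ∧
    -- an execution cannot get stuck: it continues until it terminates in step 1), and then
    -- the current pair has gap at most `ε_o` and is a pair of `ε_o`-optimal solutions
    (∀ s, Relation.ReflTransGen (SparseCov.Step S ρ β p) s₀ s →
      (s.phase ≠ SparseCov.Phase.finished ∧ ∃ s₁, SparseCov.Step S ρ β p s s₁) ∨
      (s.phase = SparseCov.Phase.finished ∧
        SparseCov.gap S ρ β s.cur ≤ p.eps ∧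
        SparseCov.IsEpsOptDual S ρ β p.eps s.cur ∧
        SparseCov.IsEpsOptPrimal S ρ β p.eps (SparseCov.Xbeta S ρ β s.cur))) := by
  refine ⟨fun U _ => ⟨SparseCov.existsUnique_isInnerMax hpd hβ U,
    SparseCov.differentiableAt_gRho hpd hβ U⟩,
    SparseCov.not_exists_infinite_run hpd hβ hρ_nonneg hp hs₀, fun s hs => ?_⟩
  obtain ⟨l, hl, -, δ, -, hpres⟩ := SparseCov.exists_invariant_step hpd hβ hρ_nonneg hp
  have hI : SparseCov.Invariant S ρ β p l δ (SparseCov.gRho S ρ β (s₀.U 0)) s := by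
    induction hs with
    | refl => exact hs₀.invariant l δ
    | tail _ hstep ih => exact hpres _ _ _ ih hstep
  by_cases hfin : s.phase = SparseCov.Phase.finished
  · have hgap := hI.finished hfin
    exact Or.inr ⟨hfin, hgap, SparseCov.isEpsOptDual_of_gap_le hpd hβ hρ_nonneg hI.cur_mem hgap,
      SparseCov.isEpsOptPrimal_of_gap_le hpd hβ hρ_nonneg hI.cur_mem hgap⟩
  · exact Or.inl ⟨hfin, SparseCov.exists_step hp hl hI hfin⟩
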